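/- Let $V$ be a finite non-empty set and let $V_2$ be the set of arcs, i.e. ordered pairs $ij$ of distinct elements $i, j \in V$. Let the preorder polytope of $V$ be the convex hull in $\mathbb{R}^{V_2}$ of the vectors $x \in \{0,1\}^{V_2}$ that satisfy $x_{ij} + x_{jk} - x_{ik} \le 1$ for all pairwise distinct $i, j, k \in V$. Let $k \ge 3$ be odd, and let $v \colon \{0,\dots,k-1\} \to V$ be injective. Then the odd closed walk inequality $$\sum_{i=0}^{k-1} \left( x_{v_i v_{i+1}} - x_{v_i v_{i+2}} \right) \le \frac{k-1}{2},$$ where the additions $i+1$ and $i+2$ in the indices are modulo $k$, defines a facet of the preorder polytope. That is, every point of the preorder polytope satisfies the inequality, and the set of points of the preorder polytope that satisfy it with equality is non-empty and has dimension exactly one less than the dimension of the preorder polytope. -/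

import Mathlib

/-- The arcs on the node set `V`: the ordered pairs of distinct nodes. -/
abbrev Arc (V : Type*) : Type _ := {p : V × V // p.1 ≠ p.2}

/-- Feasible solutions of the integer linear program of the preordering problem:
`x i j ∈ {0, 1}` for every arc `ij`, and `x i j + x j k - x i k ≤ 1` for every triple `ijk` of
pairwise distinct nodes. -/
def IsPreorderFeasible {V : Type*} (x : Arc V → ℝ) : Prop :=
  (∀ a : Arc V, x a = 0 ∨ x a = 1) ∧
    ∀ (i j k : V) (hij : i ≠ j) (hjk : j ≠ k) (hik : i ≠ k),
      x ⟨(i, j), hij⟩ + x ⟨(j, k), hjk⟩ - x ⟨(i, k), hik⟩ ≤ 1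

/-- The preorder polytope: the convex hull of the feasible solutions. -/
def preorderPolytope (V : Type*) : Set (Arc V → ℝ) :=
  convexHull ℝ {x : Arc V → ℝ | IsPreorderFeasible x}

/-- The inequality `f x ≤ b` defines a facet of `P`: it is valid for `P`, and the face of `P`
that it induces is non-empty and has dimension `dim P - 1`. The dimension of a non-empty set is
the dimension of the direction of its affine span. -/
def DefinesFacet {E : Type*} [AddCommGroup E] [Module ℝ E] [FiniteDimensional ℝ E]
    (P : Set E) (f : E →ₗ[ℝ] ℝ) (b : ℝ) : Prop :=
  (∀ x ∈ P, f x ≤ b) ∧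
    {x ∈ P | f x = b}.Nonempty ∧
    Module.finrank ℝ (vectorSpan ℝ {x ∈ P | f x = b}) + 1 =
      Module.finrank ℝ (vectorSpan ℝ P)

/-- The index `i + s` modulo `k`. -/
def cyclicShift {k : ℕ} (i : Fin k) (s : ℕ) : Fin k :=
  ⟨((i : ℕ) + s) % k, Nat.mod_lt _ i.pos⟩

theorem ne_cyclicShift {k : ℕ} (i : Fin k) {s : ℕ} (h0 : 0 < s) (hs : s < k) :
    i ≠ cyclicShift i s := by
  intro h
  have h' : (i : ℕ) = ((i : ℕ) + s) % k := congrArg Fin.val h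
  have hi := i.isLt
  rcases lt_or_ge ((i : ℕ) + s) k with h1 | h1
  · rw [Nat.mod_eq_of_lt h1] at h'
    omega
  · rw [Nat.mod_eq_sub_mod h1, Nat.mod_eq_of_lt (by omega)] at h'
    omega

/-- The arc from `v i` to `v (i + s)`, the index taken modulo `k`, for an injective `v`. -/
def shiftArc {V : Type*} {k : ℕ} (v : Fin k → V) (hv : Function.Injective v) (s : ℕ)
    (h0 : 0 < s) (hs : s < k) (i : Fin k) : Arc V :=
  ⟨(v i, v (cyclicShift i s)), hv.ne (ne_cyclicShift i h0 hs)⟩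

/-- The left-hand side of the odd closed walk inequality of a simple cycle `v`, as a linear form:
`x ↦ ∑ i, (x (v i) (v (i + 1)) - x (v i) (v (i + 2)))`, indices modulo `k`. -/
def oddClosedWalkForm {V : Type*} {k : ℕ} (hk : 3 ≤ k) (v : Fin k → V)
    (hv : Function.Injective v) : (Arc V → ℝ) →ₗ[ℝ] ℝ :=
  ∑ i : Fin k,
    ((LinearMap.proj (shiftArc v hv 1 (by omega) (by omega) i) : (Arc V → ℝ) →ₗ[ℝ] ℝ) -
      LinearMap.proj (shiftArc v hv 2 (by omega) (by omega) i))

/-- The linear form of the odd closed walk inequality, evaluated. -/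
theorem oddClosedWalkForm_apply {V : Type*} {k : ℕ} (hk : 3 ≤ k) (v : Fin k → V)
    (hv : Function.Injective v) (x : Arc V → ℝ) :
    oddClosedWalkForm hk v hv x =
      ∑ i : Fin k,
        (x (shiftArc v hv 1 (by omega) (by omega) i) -
          x (shiftArc v hv 2 (by omega) (by omega) i)) := by
  simp [oddClosedWalkForm]

/-!
Validity comes from adding, around the cycle, the transitivity inequalities of the consecutive
triples and the bounds `-x (v i) (v (i + 2)) ≤ 0`: twice the form is at most `k`, and since the
form is integral on feasible points and `k` is odd, it is at most `(k - 1) / 2` there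
(`oddClosedWalkForm_le`).

For the dimension, write `k = 2 * n + 1`. The polytope is full-dimensional, because it contains the
origin and the unit vectors. The face lies in a hyperplane parallel to the kernel of the form, so
it suffices that a linear form `L` that is constant on the face is a multiple of the odd closed
walk form. For each index `m`, let `M m` be the matching that consists of the arcs from
`v (m + 2 * j + 1)` to `v (m + 2 * j + 2)` for `j < n`; it leaves out only the node `v m`, and its
incidence vector lies on the face. Three comparisons determine `L`:

* `M m` with the step-one arc at `m` added is `M (m + 2)` with the step-one arc at `m + 1` added, so
  `L` takes the same value on all step-one arcs;
* `M m` together with the arcs from `v m` to `v (m + 1)` and to `v (m + 2)` is again transitive and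
  on the face, so `L` takes opposite values on the step-one and the step-two arc at `m`;
* every arc `a` of neither kind can be added to some `M m` without creating two composable arcs,
  so `L` vanishes on `a` (`exists_isChainFree_insert`). If `a` leads from `v i` to `v (i + d)`, then
  `m = i` works for even `d` and `m = i - 1` works for odd `d`; if it has an endpoint outside the
  cycle, one leaves the other endpoint isolated.
-/

/-! ### Indices modulo `k` -/

section CyclicShift

variable {k : ℕ}

theorem cyclicShift_zero (m : Fin k) : cyclicShift m 0 = m :=
  Fin.ext (Nat.mod_eq_of_lt m.isLt)

theorem cyclicShift_self (m : Fin k) : cyclicShift m k = m :=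
  Fin.ext (by simp [cyclicShift, Nat.mod_eq_of_lt m.isLt])

theorem cyclicShift_cyclicShift (m : Fin k) (s t : ℕ) :
    cyclicShift (cyclicShift m s) t = cyclicShift m (s + t) :=
  Fin.ext (by simp [cyclicShift, add_assoc])

theorem cyclicShift_inj (m : Fin k) {s t : ℕ} (hs : s < k) (ht : t < k) :
    cyclicShift m s = cyclicShift m t ↔ s = t := by
  refine ⟨fun h => ?_, fun h => by rw [h]⟩
  have h' : ((m : ℕ) + s) % k = ((m : ℕ) + t) % k := congrArg Fin.val h
  exact Nat.ModEq.eq_of_lt_of_lt (Nat.ModEq.add_left_cancel' (m : ℕ) h') hs ht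

theorem exists_cyclicShift_eq (m i : Fin k) : ∃ t < k, cyclicShift m t = i := by
  have hm := m.isLt
  have hi := i.isLt
  refine ⟨((i : ℕ) + (k - m)) % k, Nat.mod_lt _ m.pos, Fin.ext ?_⟩
  have h : (m : ℕ) + ((i : ℕ) + (k - m)) = i + k := by omega
  simp [cyclicShift, h, Nat.mod_eq_of_lt hi]

theorem cyclicShift_bijective (s : ℕ) :
    Function.Bijective fun i : Fin k => cyclicShift i s := by
  refine Finite.injective_iff_bijective.mp fun i j h => ?_
  have h' : ((i : ℕ) + s) % k = ((j : ℕ) + s) % k := congrArg Fin.val h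
  exact Fin.ext (Nat.ModEq.eq_of_lt_of_lt (Nat.ModEq.add_right_cancel' s h') i.isLt j.isLt)

end CyclicShift

/-! ### Incidence vectors of sets of arcs -/

section Incidence

variable {V : Type*} [DecidableEq V]

/-- The incidence vector of a finite set of arcs. -/
def arcIncidence (S : Finset (Arc V)) : Arc V → ℝ :=
  ∑ a ∈ S, Pi.single a 1

theorem arcIncidence_apply (S : Finset (Arc V)) (a : Arc V) :
    arcIncidence S a = if a ∈ S then 1 else 0 := by
  simp [arcIncidence, Finset.sum_apply, Pi.single_apply]

theorem arcIncidence_insert {S : Finset (Arc V)} {a : Arc V} (ha : a ∉ S) :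
    arcIncidence (insert a S) = Pi.single a 1 + arcIncidence S :=
  Finset.sum_insert ha

/-- No arc of `S` ends where an arc of `S` starts. -/
def IsChainFree (S : Finset (Arc V)) : Prop :=
  ∀ a ∈ S, ∀ b ∈ S, a.1.2 ≠ b.1.1

theorem IsChainFree.insert {S : Finset (Arc V)} (hS : IsChainFree S) {a : Arc V}
    (h₁ : ∀ b ∈ S, b.1.2 ≠ a.1.1) (h₂ : ∀ b ∈ S, b.1.1 ≠ a.1.2) :
    IsChainFree (insert a S) := by
  intro b hb c hc
  rw [Finset.mem_insert] at hb hc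
  rcases hb with rfl | hb <;> rcases hc with rfl | hc
  · exact c.2.symm
  · exact (h₂ c hc).symm
  · exact h₁ b hb
  · exact hS b hb c hc

theorem isPreorderFeasible_arcIncidence {S : Finset (Arc V)}
    (hS : ∀ a ∈ S, ∀ b ∈ S, a.1.2 = b.1.1 → ∀ h : a.1.1 ≠ b.1.2,
      (⟨(a.1.1, b.1.2), h⟩ : Arc V) ∈ S) :
    IsPreorderFeasible (arcIncidence S) := by
  refine ⟨fun a => ?_, fun i j l hij hjl hil => ?_⟩
  · rw [arcIncidence_apply]
    split_ifs <;> simp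
  · have h := fun h₁ h₂ => hS ⟨(i, j), hij⟩ h₁ ⟨(j, l), hjl⟩ h₂ rfl hil
    simp only [arcIncidence_apply]
    by_cases h₁ : (⟨(i, j), hij⟩ : Arc V) ∈ S
    · by_cases h₂ : (⟨(j, l), hjl⟩ : Arc V) ∈ S
      · simp [h₁, h₂, h h₁ h₂]
      · rw [if_pos h₁, if_neg h₂]
        split_ifs <;> norm_num
    · rw [if_neg h₁]
      split_ifs <;> norm_num

theorem IsChainFree.isPreorderFeasible {S : Finset (Arc V)} (hS : IsChainFree S) :
    IsPreorderFeasible (arcIncidence S) :=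
  isPreorderFeasible_arcIncidence fun a ha b hb h => absurd h (hS a ha b hb)

theorem arcIncidence_mem_preorderPolytope {S : Finset (Arc V)}
    (hS : IsPreorderFeasible (arcIncidence S)) : arcIncidence S ∈ preorderPolytope V :=
  subset_convexHull ℝ _ hS

/-- The preorder polytope is full-dimensional: it contains the origin and the unit vectors. -/
theorem vectorSpan_preorderPolytope [Finite V] :
    vectorSpan ℝ (preorderPolytope V) = ⊤ := by
  have h0 : (0 : Arc V → ℝ) ∈ preorderPolytope V := by
    have : IsChainFree (∅ : Finset (Arc V)) := by simp [IsChainFree]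
    simpa [arcIncidence] using arcIncidence_mem_preorderPolytope this.isPreorderFeasible
  rw [eq_top_iff, ← (Pi.basisFun ℝ (Arc V)).span_eq, Submodule.span_le]
  rintro _ ⟨a, rfl⟩
  have ha : IsChainFree ({a} : Finset (Arc V)) := by
    intro b hb c hc
    rw [Finset.mem_singleton] at hb hc
    rw [hb, hc]
    exact a.2.symm
  have h1 : (Pi.single a 1 : Arc V → ℝ) ∈ preorderPolytope V := by
    simpa [arcIncidence] using arcIncidence_mem_preorderPolytope ha.isPreorderFeasible
  simpa using vsub_mem_vectorSpan ℝ h1 h0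

end Incidence

/-! ### Validity -/

section Valid

variable {V : Type*} {k : ℕ} (hk : 3 ≤ k) (v : Fin k → V) (hv : Function.Injective v)

theorem two_mul_oddClosedWalkForm_le {x : Arc V → ℝ} (hx : IsPreorderFeasible x) :
    2 * oddClosedWalkForm hk v hv x ≤ k := by
  rw [oddClosedWalkForm_apply]
  have hshift : ∑ i : Fin k, x (shiftArc v hv 1 (by omega) (by omega) (cyclicShift i 1)) =
      ∑ i : Fin k, x (shiftArc v hv 1 (by omega) (by omega) i) :=
    (cyclicShift_bijective 1).sum_comp
      fun i => x (shiftArc v hv 1 (by omega) (by omega) i)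
  have hterm : ∀ i : Fin k, x (shiftArc v hv 1 (by omega) (by omega) i) +
      x (shiftArc v hv 1 (by omega) (by omega) (cyclicShift i 1)) -
      2 * x (shiftArc v hv 2 (by omega) (by omega) i) ≤ 1 := by
    intro i
    have h := hx.2 (v i) (v (cyclicShift i 1)) (v (cyclicShift (cyclicShift i 1) 1))
      (hv.ne (ne_cyclicShift i (by omega) (by omega)))
      (hv.ne (ne_cyclicShift _ (by omega) (by omega)))
      (hv.ne (by
        rw [cyclicShift_cyclicShift]
        exact ne_cyclicShift i (by omega) (by omega)))
    have h0 : 0 ≤ x (shiftArc v hv 2 (by omega) (by omega) i) := by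
      rcases hx.1 (shiftArc v hv 2 (by omega) (by omega) i) with h | h <;> simp [h]
    simp only [cyclicShift_cyclicShift] at h
    simp only [shiftArc, cyclicShift_cyclicShift] at h0 ⊢
    linarith
  have hsum := Finset.sum_le_sum fun i (_ : i ∈ Finset.univ) => hterm i
  simp only [Finset.sum_sub_distrib, Finset.sum_add_distrib, ← Finset.mul_sum, hshift,
    Finset.sum_const, Finset.card_univ, Fintype.card_fin, nsmul_eq_mul, mul_one] at hsum
  rw [Finset.sum_sub_distrib]
  linarith

theorem oddClosedWalkForm_le (hodd : Odd k) {x : Arc V → ℝ} (hx : x ∈ preorderPolytope V) :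
    oddClosedWalkForm hk v hv x ≤ ((k : ℝ) - 1) / 2 := by
  refine convexHull_min (fun y hy => ?_)
    (convex_halfSpace_le (oddClosedWalkForm hk v hv).isLinear (((k : ℝ) - 1) / 2)) hx
  have hint : ∀ a, ∃ z : ℤ, y a = z := fun a => by
    rcases hy.1 a with h | h
    · exact ⟨0, by simp [h]⟩
    · exact ⟨1, by simp [h]⟩
  choose z hz using hint
  have h2 := two_mul_oddClosedWalkForm_le hk v hv hy
  obtain ⟨n, rfl⟩ := hodd
  simp only [Set.mem_ofPred_eq]
  rw [oddClosedWalkForm_apply] at h2 ⊢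
  simp only [hz] at h2 ⊢
  norm_cast at h2
  have h3 : ∑ i : Fin (2 * n + 1), (z (shiftArc v hv 1 (by omega) (by omega) i) -
      z (shiftArc v hv 2 (by omega) (by omega) i)) ≤ (n : ℤ) := by
    push_cast at h2
    omega
  have h4 : ((∑ i : Fin (2 * n + 1), (z (shiftArc v hv 1 (by omega) (by omega) i) -
      z (shiftArc v hv 2 (by omega) (by omega) i)) : ℤ) : ℝ) ≤ n := by
    exact_mod_cast h3
  push_cast at h4 ⊢
  linarith

end Valid

/-! ### The form on unit vectors -/

section UnitVectors

variable {V : Type*} {k : ℕ} (v : Fin k → V) (hv : Function.Injective v)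

theorem shiftArc_injective {s : ℕ} (h0 : 0 < s) (hs : s < k) :
    Function.Injective (shiftArc v hv s h0 hs) := fun _ _ h =>
  hv (congrArg (fun a : Arc V => a.1.1) h)

theorem shiftArc_one_ne_shiftArc_two (hk : 3 ≤ k) (i j : Fin k) :
    shiftArc v hv 1 (by omega) (by omega) i ≠ shiftArc v hv 2 (by omega) (by omega) j := by
  intro h
  obtain rfl : i = j := hv (congrArg (fun a : Arc V => a.1.1) h)
  have h2 := hv (congrArg (fun a : Arc V => a.1.2) h)
  rw [cyclicShift_inj i (by omega) (by omega)] at h2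
  omega

variable [DecidableEq V]

theorem oddClosedWalkForm_single_shiftArc_one (hk : 3 ≤ k) (i : Fin k) :
    oddClosedWalkForm hk v hv (Pi.single (shiftArc v hv 1 (by omega) (by omega) i) 1) = 1 := by
  rw [oddClosedWalkForm_apply]
  simp [Pi.single_apply, (shiftArc_injective v hv _ _).eq_iff,
    (shiftArc_one_ne_shiftArc_two v hv hk _ _).symm]

theorem oddClosedWalkForm_single_shiftArc_two (hk : 3 ≤ k) (i : Fin k) :
    oddClosedWalkForm hk v hv (Pi.single (shiftArc v hv 2 (by omega) (by omega) i) 1) = -1 := by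
  rw [oddClosedWalkForm_apply]
  simp [Pi.single_apply, (shiftArc_injective v hv _ _).eq_iff,
    shiftArc_one_ne_shiftArc_two v hv hk _ _]

theorem oddClosedWalkForm_single_of_ne (hk : 3 ≤ k) {a : Arc V}
    (h1 : ∀ i, shiftArc v hv 1 (by omega) (by omega) i ≠ a)
    (h2 : ∀ i, shiftArc v hv 2 (by omega) (by omega) i ≠ a) :
    oddClosedWalkForm hk v hv (Pi.single a 1) = 0 := by
  rw [oddClosedWalkForm_apply]
  simp [h1, h2]

end UnitVectors

/-! ### Near-perfect matchings of the cycle -/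

section Matching

variable {V : Type*} [DecidableEq V] {k n : ℕ} (hk : 3 ≤ k) (v : Fin k → V)
  (hv : Function.Injective v)

/-- The arcs from `v (m + 2 * j + 1)` to `v (m + 2 * j + 2)` for `j < n`. For `k = 2 * n + 1`, they
match all nodes of the cycle but `v m`. -/
def cycleMatching (n : ℕ) (m : Fin k) : Finset (Arc V) :=
  (Finset.range n).image fun j =>
    shiftArc v hv 1 (by omega) (by omega) (cyclicShift m (2 * j + 1))

theorem mem_cycleMatching {m : Fin k} {a : Arc V} :
    a ∈ cycleMatching hk v hv n m ↔ ∃ j < n,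
      shiftArc v hv 1 (by omega) (by omega) (cyclicShift m (2 * j + 1)) = a := by
  simp [cycleMatching]

theorem cycleMatching_fst {m : Fin k} {a : Arc V} (ha : a ∈ cycleMatching hk v hv n m) :
    ∃ j < n, a.1.1 = v (cyclicShift m (2 * j + 1)) := by
  obtain ⟨j, hj, rfl⟩ := (mem_cycleMatching hk v hv).mp ha
  exact ⟨j, hj, rfl⟩

theorem cycleMatching_snd {m : Fin k} {a : Arc V} (ha : a ∈ cycleMatching hk v hv n m) :
    ∃ j < n, a.1.2 = v (cyclicShift m (2 * j + 2)) := by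
  obtain ⟨j, hj, rfl⟩ := (mem_cycleMatching hk v hv).mp ha
  exact ⟨j, hj, by simp only [shiftArc, cyclicShift_cyclicShift]⟩

variable (hn : k = 2 * n + 1)
include hn

theorem arcIncidence_cycleMatching (m : Fin k) :
    arcIncidence (cycleMatching hk v hv n m) = ∑ j ∈ Finset.range n,
      Pi.single (shiftArc v hv 1 (by omega) (by omega) (cyclicShift m (2 * j + 1))) 1 := by
  refine Finset.sum_image fun i hi j hj h => ?_
  simp only [Finset.coe_range, Set.mem_Iio] at hi hj
  have h' := shiftArc_injective v hv _ _ h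
  rw [cyclicShift_inj m (by omega) (by omega)] at h'
  omega

theorem isChainFree_cycleMatching (m : Fin k) : IsChainFree (cycleMatching hk v hv n m) := by
  intro a ha b hb h
  obtain ⟨i, hi, hi'⟩ := cycleMatching_snd hk v hv ha
  obtain ⟨j, hj, hj'⟩ := cycleMatching_fst hk v hv hb
  rw [hi', hj'] at h
  have h' := hv h
  rw [cyclicShift_inj m (by omega) (by omega)] at h'
  omega

theorem oddClosedWalkForm_cycleMatching (m : Fin k) :
    oddClosedWalkForm hk v hv (arcIncidence (cycleMatching hk v hv n m)) = ((k : ℝ) - 1) / 2 := by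
  rw [arcIncidence_cycleMatching hk v hv hn, map_sum]
  simp only [oddClosedWalkForm_single_shiftArc_one]
  simp [hn]

theorem shiftArc_notMem_cycleMatching {s : ℕ} (h0 : 0 < s) (hs : s < k) (m : Fin k) :
    shiftArc v hv s h0 hs m ∉ cycleMatching hk v hv n m := by
  intro h
  obtain ⟨j, hj, hj'⟩ := cycleMatching_fst hk v hv h
  have h' : cyclicShift m 0 = cyclicShift m (2 * j + 1) := by
    rw [cyclicShift_zero]
    exact hv hj'
  rw [cyclicShift_inj m (by omega) (by omega)] at h'
  omega

/-- The matching that leaves out `v m`, extended by the step-one arc at `m`, is the matching that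
leaves out `v (m + 2)`, extended by the step-one arc at `m + 1`. -/
theorem arcIncidence_cycleMatching_add (m : Fin k) :
    arcIncidence (cycleMatching hk v hv n m) +
        Pi.single (shiftArc v hv 1 (by omega) (by omega) m) 1 =
      arcIncidence (cycleMatching hk v hv n (cyclicShift m 2)) +
        Pi.single (shiftArc v hv 1 (by omega) (by omega) (cyclicShift m 1)) 1 := by
  -- Both sides are the sum over `j < n + 1` of the arcs of the first matching: its last term
  -- starts at `m + k = m`, its first one at `m + 1`.
  have h1 := Finset.sum_range_succ (fun j => (Pi.single (shiftArc v hv 1 (by omega) (by omega)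
    (cyclicShift m (2 * j + 1))) 1 : Arc V → ℝ)) n
  have h2 := Finset.sum_range_succ' (fun j => (Pi.single (shiftArc v hv 1 (by omega) (by omega)
    (cyclicShift m (2 * j + 1))) 1 : Arc V → ℝ)) n
  rw [h1] at h2
  simp only [← hn, cyclicShift_self, mul_zero, zero_add] at h2
  rw [arcIncidence_cycleMatching hk v hv hn, arcIncidence_cycleMatching hk v hv hn, h2]
  congr 1
  refine Finset.sum_congr rfl fun j _ => ?_
  rw [cyclicShift_cyclicShift, show 2 + (2 * j + 1) = 2 * (j + 1) + 1 by ring]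

/-- The matching that leaves out `v m` stays transitive when `v m` is put below both ends of the
arc from `v (m + 1)` to `v (m + 2)`. -/
theorem isPreorderFeasible_insert_insert_cycleMatching (m : Fin k) :
    IsPreorderFeasible (arcIncidence (insert (shiftArc v hv 1 (by omega) (by omega) m)
      (insert (shiftArc v hv 2 (by omega) (by omega) m) (cycleMatching hk v hv n m)))) := by
  refine isPreorderFeasible_arcIncidence fun a ha b hb hab hne => ?_
  have hsnd : a = shiftArc v hv 1 (by omega) (by omega) m ∨
      ∃ j < n, a.1.2 = v (cyclicShift m (2 * j + 2)) := by
    rcases Finset.mem_insert.mp ha with h | h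
    · exact Or.inl h
    rcases Finset.mem_insert.mp h with rfl | h
    · exact Or.inr ⟨0, by omega, rfl⟩
    · exact Or.inr (cycleMatching_snd hk v hv h)
  have hfst : b.1.1 = v (cyclicShift m 0) ∨ b ∈ cycleMatching hk v hv n m := by
    rw [cyclicShift_zero]
    rcases Finset.mem_insert.mp hb with rfl | h
    · exact Or.inl rfl
    rcases Finset.mem_insert.mp h with rfl | h
    · exact Or.inl rfl
    · exact Or.inr h
  rcases hsnd with rfl | ⟨i, hi, hi'⟩
  · rcases hfst with h | h
    · rw [h] at hab
      have h' := hv hab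
      rw [cyclicShift_inj m (by omega) (by omega)] at h'
      omega
    · obtain ⟨j, hj, rfl⟩ := (mem_cycleMatching hk v hv).mp h
      have h' := hv hab
      rw [cyclicShift_inj m (by omega) (by omega)] at h'
      obtain rfl : j = 0 := by omega
      refine Finset.mem_insert_of_mem (Finset.mem_insert.mpr (Or.inl (Subtype.ext ?_)))
      simp only [shiftArc, cyclicShift_cyclicShift]
  · exfalso
    rw [hi'] at hab
    rcases hfst with h | h
    · rw [h] at hab
      have h' := hv hab
      rw [cyclicShift_inj m (by omega) (by omega)] at h'
      omega
    · obtain ⟨j, hj, hj'⟩ := cycleMatching_fst hk v hv h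
      rw [hj'] at hab
      have h' := hv hab
      rw [cyclicShift_inj m (by omega) (by omega)] at h'
      omega

/-- Every arc can be added to one of the matchings without creating two composable arcs, unless
it leads from some `v i` to `v (i + 1)`. -/
theorem exists_isChainFree_insert {a : Arc V}
    (h1 : ∀ i, shiftArc v hv 1 (by omega) (by omega) i ≠ a) :
    ∃ m, a ∉ cycleMatching hk v hv n m ∧ IsChainFree (insert a (cycleMatching hk v hv n m)) := by
  suffices h : ∃ m, (∀ j < n, v (cyclicShift m (2 * j + 2)) ≠ a.1.1) ∧
      ∀ j < n, v (cyclicShift m (2 * j + 1)) ≠ a.1.2 by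
    obtain ⟨m, h₁, h₂⟩ := h
    refine ⟨m, fun hm => ?_, (isChainFree_cycleMatching hk v hv hn m).insert ?_ ?_⟩
    · obtain ⟨j, -, hj⟩ := (mem_cycleMatching hk v hv).mp hm
      exact h1 _ hj
    · intro b hb
      obtain ⟨j, hj, hj'⟩ := cycleMatching_snd hk v hv hb
      exact hj' ▸ h₁ j hj
    · intro b hb
      obtain ⟨j, hj, hj'⟩ := cycleMatching_fst hk v hv hb
      exact hj' ▸ h₂ j hj
  have key : ∀ (m : Fin k) (s t : ℕ), s < k → t < k → s ≠ t →
      v (cyclicShift m s) ≠ v (cyclicShift m t) := fun m s t hs ht hst h =>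
    hst ((cyclicShift_inj m hs ht).mp (hv h))
  by_cases hp : ∃ i, v i = a.1.1
  · obtain ⟨i, hi⟩ := hp
    rw [← hi]
    by_cases hq : ∃ i', v i' = a.1.2
    · obtain ⟨i', hi'⟩ := hq
      obtain ⟨d, hd, rfl⟩ := exists_cyclicShift_eq i i'
      rw [← hi']
      rcases Nat.even_or_odd d with ⟨e, he⟩ | ⟨e, he⟩
      · refine ⟨i, fun j hj => ?_, fun j hj => key i _ _ (by omega) hd (by omega)⟩
        simpa only [cyclicShift_zero] using key i (2 * j + 2) 0 (by omega) (by omega) (by omega)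
      · obtain ⟨m, rfl⟩ := (cyclicShift_bijective 1).surjective i
        simp only [cyclicShift_cyclicShift]
        -- As `d` and `k` are odd, `d + 1 < k`, so no reduction modulo `k` changes its parity.
        exact ⟨m, fun j hj => key m _ _ (by omega) (by omega) (by omega),
          fun j hj => key m _ _ (by omega) (by omega) (by omega)⟩
    · push Not at hq
      refine ⟨i, fun j hj => ?_, fun j hj => hq _⟩
      simpa only [cyclicShift_zero] using key i (2 * j + 2) 0 (by omega) (by omega) (by omega)
  · push Not at hp
    by_cases hq : ∃ i', v i' = a.1.2
    · obtain ⟨i', hi'⟩ := hq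
      rw [← hi']
      refine ⟨i', fun j hj => hp _, fun j hj => ?_⟩
      simpa only [cyclicShift_zero] using key i' (2 * j + 1) 0 (by omega) (by omega) (by omega)
    · push Not at hq
      exact ⟨⟨0, by omega⟩, fun j hj => hp _, fun j hj => hq _⟩

end Matching

/-! ### The dimension of the face -/

section Face

variable {V : Type*} [Finite V] {k : ℕ} (hk : 3 ≤ k) (v : Fin k → V) (hv : Function.Injective v)

/-- A linear form that is constant on the face is a multiple of the odd closed walk form. -/
theorem exists_eq_smul_oddClosedWalkForm (hodd : Odd k) (L : (Arc V → ℝ) →ₗ[ℝ] ℝ)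
    (hL : ∀ x ∈ preorderPolytope V, oddClosedWalkForm hk v hv x = ((k : ℝ) - 1) / 2 →
      ∀ y ∈ preorderPolytope V, oddClosedWalkForm hk v hv y = ((k : ℝ) - 1) / 2 → L x = L y) :
    ∃ c : ℝ, L = c • oddClosedWalkForm hk v hv := by
  classical
  obtain ⟨n, hn⟩ := hodd
  have hM := fun m => arcIncidence_mem_preorderPolytope
    (isChainFree_cycleMatching hk v hv hn m).isPreorderFeasible
  have hMf := oddClosedWalkForm_cycleMatching hk v hv hn
  have hsucc : ∀ m, L (Pi.single (shiftArc v hv 1 (by omega) (by omega) (cyclicShift m 1)) 1) =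
      L (Pi.single (shiftArc v hv 1 (by omega) (by omega) m) 1) := by
    intro m
    have h := congrArg L (arcIncidence_cycleMatching_add hk v hv hn m)
    rw [map_add, map_add, hL _ (hM m) (hMf m) _ (hM (cyclicShift m 2)) (hMf _)] at h
    exact (add_left_cancel h).symm
  have hone : ∀ m, L (Pi.single (shiftArc v hv 1 (by omega) (by omega) m) 1) =
      L (Pi.single (shiftArc v hv 1 (by omega) (by omega) ⟨0, by omega⟩) 1) := by
    intro m
    obtain ⟨t, -, rfl⟩ := exists_cyclicShift_eq ⟨0, by omega⟩ m
    induction t with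
    | zero => rw [cyclicShift_zero]
    | succ t ih => rw [← cyclicShift_cyclicShift, hsucc, ih]
  have htwo : ∀ m, L (Pi.single (shiftArc v hv 2 (by omega) (by omega) m) 1) =
      -L (Pi.single (shiftArc v hv 1 (by omega) (by omega) m) 1) := by
    intro m
    have hins : arcIncidence (insert (shiftArc v hv 1 (by omega) (by omega) m)
        (insert (shiftArc v hv 2 (by omega) (by omega) m) (cycleMatching hk v hv n m))) =
        Pi.single (shiftArc v hv 1 (by omega) (by omega) m) 1 +
        (Pi.single (shiftArc v hv 2 (by omega) (by omega) m) 1 +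
          arcIncidence (cycleMatching hk v hv n m)) := by
      rw [arcIncidence_insert, arcIncidence_insert]
      · exact shiftArc_notMem_cycleMatching hk v hv hn _ _ m
      · rw [Finset.mem_insert, not_or]
        exact ⟨shiftArc_one_ne_shiftArc_two v hv hk m m,
          shiftArc_notMem_cycleMatching hk v hv hn _ _ m⟩
    have h := hL _ (arcIncidence_mem_preorderPolytope
      (isPreorderFeasible_insert_insert_cycleMatching hk v hv hn m)) (by
        rw [hins, map_add, map_add, hMf, oddClosedWalkForm_single_shiftArc_one,
          oddClosedWalkForm_single_shiftArc_two]
        ring) _ (hM m) (hMf m)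
    rw [hins, map_add, map_add] at h
    linarith
  refine ⟨L (Pi.single (shiftArc v hv 1 (by omega) (by omega) ⟨0, by omega⟩) 1),
    (Pi.basisFun ℝ (Arc V)).ext fun a => ?_⟩
  rw [Pi.basisFun_apply, LinearMap.smul_apply, smul_eq_mul]
  by_cases h1 : ∃ i, shiftArc v hv 1 (by omega) (by omega) i = a
  · obtain ⟨i, rfl⟩ := h1
    rw [oddClosedWalkForm_single_shiftArc_one, hone, mul_one]
  by_cases h2 : ∃ i, shiftArc v hv 2 (by omega) (by omega) i = a
  · obtain ⟨i, rfl⟩ := h2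
    rw [oddClosedWalkForm_single_shiftArc_two, htwo, hone, mul_neg, mul_one]
  push Not at h1 h2
  have hfa := oddClosedWalkForm_single_of_ne v hv hk h1 h2
  obtain ⟨m, ham, hfree⟩ := exists_isChainFree_insert hk v hv hn h1
  have h := hL _ (arcIncidence_mem_preorderPolytope hfree.isPreorderFeasible)
    (by rw [arcIncidence_insert ham, map_add, hfa, zero_add, hMf]) _ (hM m) (hMf m)
  rw [arcIncidence_insert ham, map_add, add_eq_right] at h
  rw [h, hfa, mul_zero]

/-- The direction of the face is the kernel of the form: by duality, it is enough that a linear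
form that vanishes on the direction vanishes on the kernel. -/
theorem vectorSpan_face_eq_ker (hodd : Odd k) :
    vectorSpan ℝ {x ∈ preorderPolytope V | oddClosedWalkForm hk v hv x = ((k : ℝ) - 1) / 2} =
      LinearMap.ker (oddClosedWalkForm hk v hv) := by
  apply le_antisymm
  · rw [vectorSpan_def, Submodule.span_le]
    rintro _ ⟨x, hx, y, hy, rfl⟩
    simp [hx.2, hy.2]
  · intro z hz
    by_contra hzW
    obtain ⟨L, hLz, hLW⟩ := Submodule.exists_le_ker_of_notMem hzW
    obtain ⟨c, rfl⟩ := exists_eq_smul_oddClosedWalkForm hk v hv hodd L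
      fun x hx hxf y hy hyf => by
        have h := hLW (vsub_mem_vectorSpan ℝ (s := {x ∈ preorderPolytope V |
          oddClosedWalkForm hk v hv x = ((k : ℝ) - 1) / 2}) ⟨hx, hxf⟩ ⟨hy, hyf⟩)
        rwa [LinearMap.mem_ker, vsub_eq_sub, map_sub, sub_eq_zero] at h
    exact hLz (by rw [LinearMap.smul_apply, LinearMap.mem_ker.mp hz, smul_zero])

end Face

theorem mainTheorem1 {V : Type*} [Finite V] (k : ℕ) (hk : 3 ≤ k) (hodd : Odd k)
    (v : Fin k → V) (hv : Function.Injective v) :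
    DefinesFacet (preorderPolytope V) (oddClosedWalkForm hk v hv) (((k : ℝ) - 1) / 2) := by
  classical
  have hne : oddClosedWalkForm hk v hv ≠ 0 := fun h => by
    have h1 := oddClosedWalkForm_single_shiftArc_one v hv hk ⟨0, by omega⟩
    rw [h, LinearMap.zero_apply] at h1
    exact zero_ne_one h1
  refine ⟨fun x hx => oddClosedWalkForm_le hk v hv hodd hx, ?_, ?_⟩
  · obtain ⟨n, hn⟩ := hodd
    exact ⟨_, arcIncidence_mem_preorderPolytope
      (isChainFree_cycleMatching hk v hv hn ⟨0, by omega⟩).isPreorderFeasible,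
      oddClosedWalkForm_cycleMatching hk v hv hn _⟩
  · rw [vectorSpan_face_eq_ker hk v hv hodd, vectorSpan_preorderPolytope, finrank_top]
    exact Module.Dual.finrank_ker_add_one_of_ne_zero hne
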